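/- All graphs are finite, undirected and simple. The spectrum of a graph is the multiset of eigenvalues of its adjacency matrix. Let $H_{11} = P_{2,2;7}^{2,4}$ be the tree with $11$ vertices obtained from the path with vertices $0,1,\dots,6$ (consecutive integers being adjacent) by attaching a pendant path with two edges at the vertex $2$ and another pendant path with two edges at the vertex $4$. Then $H_{11}$ is determined by its adjacency spectrum: every graph that has the same spectrum as $H_{11}$ is isomorphic to $H_{11}$. -/

import Mathlib

universe u v

/-- The adjacency spectrum of a finite simple graph: the multiset of eigenvalues of its
adjacency matrix, i.e. the real roots, with multiplicity, of its characteristic polynomial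
(the adjacency matrix is real symmetric, so all its eigenvalues are real). -/
noncomputable def SimpleGraph.adjSpectrum {V : Type*} [Fintype V] (G : SimpleGraph V) :
    Multiset ℝ := by
  classical exact (G.adjMatrix ℝ).charpoly.roots

/-- A finite simple graph is determined by its spectrum (DS) if every finite simple graph with
the same adjacency spectrum is isomorphic to it. -/
def SimpleGraph.IsDS {V : Type u} [Fintype V] (G : SimpleGraph V) : Prop :=
  ∀ (W : Type v) [Fintype W] (H : SimpleGraph W),
    H.adjSpectrum = G.adjSpectrum → Nonempty (H ≃g G)

/-- The graph obtained from the path on the vertices `0, 1, …, r - 1` (consecutive integers being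
adjacent) by attaching, for each `i`, a pendant path with `n i` edges at the vertex `m i`.
The vertex `Sum.inr ⟨i, j⟩` is the vertex at distance `j + 1` from `m i` on the `i`-th
pendant path. For `0 < m 0 < m 1 < ⋯ < r - 1` this is an open quipu. -/
def openQuipu {t : ℕ} (r : ℕ) (m n : Fin t → ℕ) :
    SimpleGraph (Fin r ⊕ (Σ i : Fin t, Fin (n i))) :=
  SimpleGraph.fromRel fun x y =>
    match x, y with
    | Sum.inl a, Sum.inl b => (a : ℕ) + 1 = b
    | Sum.inl a, Sum.inr ⟨i, j⟩ => (a : ℕ) = m i ∧ (j : ℕ) = 0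
    | Sum.inr ⟨i, j⟩, Sum.inr ⟨k, l⟩ => i = k ∧ (j : ℕ) + 1 = l
    | Sum.inr _, Sum.inl _ => False

/-- The H-shape tree `H_11`: the path on the vertices `0, …, 6` with a pendant path of two edges
attached at the vertex `2` and another one attached at the vertex `4`. -/
def treeH11 : SimpleGraph (Fin 7 ⊕ (Σ i : Fin 2, Fin (![2, 2] i))) :=
  openQuipu 7 ![2, 4] ![2, 2]

/-!
Cospectral graphs have the same number of vertices, the same traces of powers of the adjacency
matrix and the same rank. A graph `G` cospectral with `treeH11` therefore has `11` vertices, no odd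
closed walk, and rank `10`. It is thus bipartite, and since the rank of a bipartite graph is at most
twice the size of each side, its sides have sizes `5` and `6`. So `G` is described by five subsets
`S 0, …, S 4` of `Fin 6`, the neighbourhoods of the vertices of the smaller side; they are distinct,
because equal ones would lower the rank.

With `B` the biadjacency matrix, `N = B * Bᵀ` has the entries `#(S i ∩ S j)`, and the trace of `N ^ k`
is half the trace of the `2k`-th power of the adjacency matrix. Hence the traces of
`N, N ^ 2, N ^ 3, N ^ 4` are those of the tree: `10, 32, 124, 516`. The first two traces and
Bonferroni's inequality (`sum_card_le_card_add`) leave three possibilities for the sizes of the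
`S i`, with all pairwise intersections of size at most one. The third and fourth traces then force all
sizes to be two and `N` to be `2 + A` with `A` the adjacency matrix of the bowtie
(`exists_perm_interCardMatrix_eq`).

Five pairs with this intersection pattern are unique up to relabelling
(`exists_perm_mem_iff_of_interCardMatrix_eq`), so `G` is the tree.
-/

open Matrix

/-! ### Invariants of cospectral graphs -/

namespace Matrix.IsHermitian
variable {n : Type*} [Fintype n] [DecidableEq n]

theorem trace_pow_eq_sum_roots {A : Matrix n n ℝ} (hA : A.IsHermitian) (k : ℕ) :
    (A ^ k).trace = (A.charpoly.roots.map (· ^ k)).sum := by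
  have hpow : A ^ k = Unitary.conjStarAlgAut ℝ _ hA.eigenvectorUnitary
      (diagonal (RCLike.ofReal ∘ hA.eigenvalues) ^ k) := by
    rw [map_pow, ← hA.spectral_theorem]
  rw [hpow, Unitary.conjStarAlgAut_apply, trace_mul_comm, ← mul_assoc,
    Unitary.coe_star_mul_self, one_mul, diagonal_pow, trace_diagonal,
    hA.roots_charpoly_eq_eigenvalues]
  simp

theorem rank_eq_countP_roots {A : Matrix n n ℝ} (hA : A.IsHermitian) :
    A.rank = A.charpoly.roots.countP (· ≠ 0) := by
  rw [hA.rank_eq_card_non_zero_eigs, hA.roots_charpoly_eq_eigenvalues, Multiset.countP_map,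
    Fintype.card_subtype]
  simp [Finset.card, Finset.filter]

end Matrix.IsHermitian

namespace SimpleGraph

theorem adjMatrix_map_natCast {V : Type*} (G : SimpleGraph V) [DecidableRel G.Adj] :
    (G.adjMatrix ℕ).map (Nat.castRingHom ℝ) = G.adjMatrix ℝ := by
  ext i j
  simp [adjMatrix_apply]

section Cospectral
variable {V W : Type*} [Fintype V] [Fintype W] [DecidableEq V] [DecidableEq W]
  {G : SimpleGraph V} {H : SimpleGraph W} [DecidableRel G.Adj] [DecidableRel H.Adj]

theorem adjSpectrum_eq_roots (G : SimpleGraph V) [DecidableRel G.Adj] :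
    G.adjSpectrum = (G.adjMatrix ℝ).charpoly.roots := by
  unfold adjSpectrum
  congr!

theorem adjSpectrum_eq_of_iso (e : G ≃g H) : G.adjSpectrum = H.adjSpectrum := by
  rw [adjSpectrum_eq_roots, adjSpectrum_eq_roots, ← e.reindex_adjMatrix (α := ℝ),
    charpoly_reindex]

theorem card_adjSpectrum (G : SimpleGraph V) : G.adjSpectrum.card = Fintype.card V := by
  classical
  rw [adjSpectrum_eq_roots, (G.isHermitian_adjMatrix ℝ).roots_charpoly_eq_eigenvalues]
  simp

theorem natCast_trace_adjMatrix_pow (G : SimpleGraph V) [DecidableRel G.Adj] (k : ℕ) :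
    ((G.adjMatrix ℕ ^ k).trace : ℝ) = (G.adjSpectrum.map (· ^ k)).sum := by
  rw [adjSpectrum_eq_roots, ← (G.isHermitian_adjMatrix ℝ).trace_pow_eq_sum_roots,
    ← adjMatrix_map_natCast, ← RingHom.mapMatrix_apply, ← map_pow, RingHom.mapMatrix_apply]
  simp [trace]

theorem trace_adjMatrix_pow_eq_of_adjSpectrum_eq (h : G.adjSpectrum = H.adjSpectrum) (k : ℕ) :
    (G.adjMatrix ℕ ^ k).trace = (H.adjMatrix ℕ ^ k).trace := by
  have hk := G.natCast_trace_adjMatrix_pow k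
  rw [h, ← H.natCast_trace_adjMatrix_pow k] at hk
  exact_mod_cast hk

theorem rank_adjMatrix_eq_of_adjSpectrum_eq (h : G.adjSpectrum = H.adjSpectrum) :
    (G.adjMatrix ℝ).rank = (H.adjMatrix ℝ).rank := by
  rw [(G.isHermitian_adjMatrix ℝ).rank_eq_countP_roots, (H.isHermitian_adjMatrix ℝ).rank_eq_countP_roots,
    ← adjSpectrum_eq_roots, ← adjSpectrum_eq_roots, h]

end Cospectral

/-- The diagonal entries of the `k`-th power of the adjacency matrix count the closed walks of
length `k`, so vanishing odd traces exclude odd closed walks. -/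
theorem colorable_two_of_trace_odd_pow {V : Type*} [Fintype V] [DecidableEq V]
    (G : SimpleGraph V) [DecidableRel G.Adj]
    (h : ∀ k, Odd k → (G.adjMatrix ℕ ^ k).trace = 0) : G.Colorable 2 := by
  rw [two_colorable_iff_forall_loop_even]
  intro u w
  by_contra hw
  have h0 := h _ (Nat.not_even_iff_odd.mp hw)
  rw [trace, Finset.sum_eq_zero_iff] at h0
  have h1 := h0 u (Finset.mem_univ u)
  rw [diag_apply, adjMatrix_pow_apply_eq_card_walk, Nat.cast_id, Fintype.card_eq_zero_iff] at h1
  exact h1.elim ⟨w, rfl⟩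

end SimpleGraph

/-! ### Bipartite graphs given by the neighbourhoods of one side -/

section Bipartite
variable {m n m' n' : Type*}

/-- The bipartite graph with sides `m` and `n` in which `i : m` has the neighbourhood `S i`. -/
def bipartiteGraph (S : m → Finset n) : SimpleGraph (m ⊕ n) where
  Adj
    | .inl i, .inr j => j ∈ S i
    | .inr j, .inl i => j ∈ S i
    | _, _ => False
  symm := ⟨by rintro (i | j) (i' | j') <;> simp⟩
  loopless := ⟨by rintro (i | j) <;> simp⟩

instance [DecidableEq n] (S : m → Finset n) : DecidableRel (bipartiteGraph S).Adj
  | .inl i, .inr j => inferInstanceAs (Decidable (j ∈ S i))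
  | .inr j, .inl i => inferInstanceAs (Decidable (j ∈ S i))
  | .inl _, .inl _ => inferInstanceAs (Decidable False)
  | .inr _, .inr _ => inferInstanceAs (Decidable False)

/-- The biadjacency matrix of `bipartiteGraph S`: its `i`-th row is the indicator of `S i`. -/
def biadjMatrix (R : Type*) [Zero R] [One R] [DecidableEq n] (S : m → Finset n) : Matrix m n R :=
  of fun i j => if j ∈ S i then 1 else 0

theorem biadjMatrix_mul_transpose [Fintype n] [DecidableEq n] (S : m → Finset n) :
    biadjMatrix ℕ S * (biadjMatrix ℕ S)ᵀ = of fun i j => (S i ∩ S j).card := by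
  ext i j
  simp only [biadjMatrix, mul_apply, of_apply, transpose_apply, ite_zero_mul_ite_zero, mul_one,
    Finset.sum_boole, Nat.cast_id]
  congr 1
  ext k
  simp

theorem adjMatrix_bipartiteGraph (R : Type*) [Zero R] [One R] [DecidableEq n] (S : m → Finset n) :
    (bipartiteGraph S).adjMatrix R = fromBlocks 0 (biadjMatrix R S) (biadjMatrix R S)ᵀ 0 := by
  ext (i | j) (i' | j') <;> rw [SimpleGraph.adjMatrix_apply] <;>
    simp [bipartiteGraph, biadjMatrix] <;> congr

/-- Relabelling both sides of a bipartite graph. -/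
def bipartiteGraphIso {S : m → Finset n} {S' : m' → Finset n'} (e : m ≃ m') (f : n ≃ n')
    (h : ∀ i j, f j ∈ S' (e i) ↔ j ∈ S i) : bipartiteGraph S ≃g bipartiteGraph S' where
  toEquiv := e.sumCongr f
  map_rel_iff' := by rintro (i | j) (i' | j') <;> simp [bipartiteGraph, h]

theorem SimpleGraph.nonempty_iso_bipartiteGraph {V : Type*} [Fintype V] (G : SimpleGraph V)
    (p : V → Prop) (hp : ∀ u v, G.Adj u v → (p u ↔ ¬ p v)) :
    ∃ S : Fin (Nat.card {v // p v}) → Finset (Fin (Nat.card {v // ¬ p v})),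
      Nonempty (G ≃g bipartiteGraph S) := by
  classical
  let e := Finite.equivFin {v // p v}
  let f := Finite.equivFin {v // ¬ p v}
  refine ⟨fun i => {j | G.Adj (e.symm i) (f.symm j)},
    ⟨⟨(Equiv.sumCompl p).symm.trans (e.sumCongr f), ?_⟩⟩⟩
  intro u v
  by_cases hu : p u <;> by_cases hv : p v
  · have : ¬ G.Adj u v := fun h => (hp u v h).mp hu hv
    simp [hu, hv, bipartiteGraph, this]
  · simp [hu, hv, bipartiteGraph]
  · simp [hu, hv, bipartiteGraph, G.adj_comm]
  · have : ¬ G.Adj u v := fun h => hu ((hp u v h).mpr hv)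
    simp [hu, hv, bipartiteGraph, this]

theorem SimpleGraph.Colorable.exists_iso_bipartiteGraph {V : Type*} [Fintype V]
    {G : SimpleGraph V} (hG : G.Colorable 2) :
    ∃ a b : ℕ, a ≤ b ∧ a + b = Fintype.card V ∧
      ∃ S : Fin a → Finset (Fin b), Nonempty (G ≃g bipartiteGraph S) := by
  classical
  obtain ⟨C⟩ := hG
  have key : ∀ p : V → Prop, (∀ u v, G.Adj u v → (p u ↔ ¬ p v)) →
      Nat.card {v // p v} ≤ Nat.card {v // ¬ p v} → _ := fun p hp hle =>
    (⟨_, _, hle, by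
      simp only [Nat.card_eq_fintype_card, Fintype.card_subtype_compl]
      exact Nat.add_sub_of_le (Fintype.card_subtype_le p),
      G.nonempty_iso_bipartiteGraph p hp⟩ : ∃ a b : ℕ, a ≤ b ∧ a + b = Fintype.card V ∧
      ∃ S : Fin a → Finset (Fin b), Nonempty (G ≃g bipartiteGraph S))
  have hp : ∀ u v, G.Adj u v → (C u = 0 ↔ ¬ C v = 0) := by
    intro u v h
    have := C.valid h
    omega
  rcases le_total (Nat.card {v // C v = 0}) (Nat.card {v // ¬ C v = 0}) with hle | hle
  · exact key _ hp hle
  · refine key (fun v => ¬ C v = 0) (fun u v h => not_congr (hp u v h)) ?_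
    simpa only [not_not] using hle

variable [Fintype m] [Fintype n]

theorem Matrix.trace_fromBlocks {R : Type*} [AddCommMonoid R] (A : Matrix m m R) (B : Matrix m n R)
    (C : Matrix n m R) (D : Matrix n n R) :
    (fromBlocks A B C D).trace = A.trace + D.trace := by
  simp [trace]

variable [DecidableEq m]

section

variable {R : Type*} [CommSemiring R] (M : Matrix m n R)

/-- Even powers of `fromBlocks 0 M Mᵀ 0` are block diagonal with blocks `(M * Mᵀ) ^ k` and
`(Mᵀ * M) ^ k`, whose traces agree for `k ≠ 0`. -/
theorem trace_fromBlocks_pow_two_mul [DecidableEq n] {k : ℕ} (hk : k ≠ 0) :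
    (fromBlocks 0 M Mᵀ 0 ^ (2 * k)).trace = 2 * ((M * Mᵀ) ^ k).trace := by
  have h : ∀ k, fromBlocks 0 M Mᵀ 0 ^ (2 * k)
      = fromBlocks ((M * Mᵀ) ^ k) 0 0 ((Mᵀ * M) ^ k) := by
    intro k
    rw [pow_mul, pow_two, fromBlocks_multiply]
    simp only [mul_zero, zero_add, add_zero, Matrix.zero_mul, Matrix.mul_zero]
    exact fromBlocks_diagonal_pow _ _ k
  obtain ⟨l, rfl⟩ := Nat.exists_eq_succ_of_ne_zero hk
  rw [h, trace_fromBlocks, two_mul]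
  congr 1
  have : ∀ l, (Mᵀ * M) ^ (l+1) = Mᵀ * ((M * Mᵀ) ^ l * M) := by
    intro l
    induction l with
    | zero => simp
    | succ l ih => rw [pow_succ', ih, pow_succ']; simp only [Matrix.mul_assoc]
  rw [this, trace_mul_comm, Matrix.mul_assoc, ← pow_succ]

theorem trace_fromBlocks_pow_odd [DecidableEq n] {k : ℕ} (hk : Odd k) :
    (fromBlocks 0 M Mᵀ 0 ^ k).trace = 0 := by
  obtain ⟨l, rfl⟩ := hk
  rw [pow_succ, pow_mul, pow_two, fromBlocks_multiply]
  simp only [mul_zero, zero_add, add_zero, Matrix.zero_mul, Matrix.mul_zero]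
  rw [fromBlocks_diagonal_pow, fromBlocks_multiply, trace_fromBlocks]
  simp

/-- If the rows of the upper right block take their values among the rows of `M'`, the rank is at
most the number of rows of `M'` plus the number of rows of the block. -/
theorem rank_fromBlocks_submatrix_le [StrongRankCondition R] {k : Type*} [Fintype k]
    [DecidableEq k] (M' : Matrix k n R) (f : m → k) (N : Matrix n m R) :
    (fromBlocks 0 (M'.submatrix f id) N 0).rank ≤ Fintype.card k + Fintype.card m := by
  have h : fromBlocks 0 (M'.submatrix f id) N 0 =
      fromBlocks ((1 : Matrix k k R).submatrix f id) 0 0 N *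
        fromBlocks 0 M' (1 : Matrix m m R) 0 := by
    rw [fromBlocks_multiply]
    have h1 : (1 : Matrix k k R).submatrix f id * M' = M'.submatrix f id := by
      ext i j
      simp [mul_apply, one_apply]
    simp [h1]
  rw [h]
  refine (rank_mul_le_left _ _).trans ((rank_le_card_width _).trans ?_)
  simp

/-- If `M` has a right inverse, the bipartite matrix `fromBlocks 0 M Mᵀ 0` can be multiplied on
both sides to give the identity of twice the number of rows of `M`. -/
theorem le_rank_fromBlocks [Nontrivial R] [StrongRankCondition R]
    {S : Matrix n m R} (hS : M * S = 1) :
    2 * Fintype.card m ≤ (fromBlocks 0 M Mᵀ 0).rank := by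
  have h : fromBlocks (1 : Matrix m m R) 0 0 Sᵀ *
      (fromBlocks 0 M Mᵀ 0 * fromBlocks 0 (1 : Matrix m m R) S 0) = 1 := by
    simp [fromBlocks_multiply, hS, ← transpose_mul]
  have := (rank_mul_le_right _ _).trans (rank_mul_le_left (fromBlocks 0 M Mᵀ 0)
    (fromBlocks 0 (1 : Matrix m m R) S 0)) |>.trans' (congrArg rank h).ge
  rw [rank_one] at this
  simpa [two_mul] using this

end

end Bipartite

/-! ### The tree as a bipartite graph -/

/-- The neighbourhoods, in the larger colour class of `treeH11`, of the five vertices of the smaller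
one: `0` stands for the vertex `3` of the path, and `1, 2` and `3, 4` for the neighbours of the
vertices `2` and `4` other than `3`. -/
def treeH11Nbhd : Fin 5 → Finset (Fin 6) :=
  ![{0, 1}, {0, 2}, {0, 3}, {1, 4}, {1, 5}]

/-- The vertices of `treeH11` named by the two sides of `bipartiteGraph treeH11Nbhd`; the right side
lists the branching vertices `2` and `4` first. -/
def treeH11Vertex : Fin 5 ⊕ Fin 6 → Fin 7 ⊕ (Σ i : Fin 2, Fin (![2, 2] i))
  | .inl i => ![.inl 3, .inl 1, .inr ⟨0, (0 : Fin 2)⟩, .inl 5, .inr ⟨1, (0 : Fin 2)⟩] i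
  | .inr j => ![.inl 2, .inl 4, .inl 0, .inr ⟨0, (1 : Fin 2)⟩, .inl 6, .inr ⟨1, (1 : Fin 2)⟩] j

instance : DecidableRel treeH11.Adj := fun x y => by
  unfold treeH11 openQuipu SimpleGraph.fromRel
  dsimp only
  refine @instDecidableAnd _ _ _ (@instDecidableOr _ _ ?_ ?_)
  · rcases x with a | ⟨i, j⟩ <;> rcases y with b | ⟨k, l⟩ <;> dsimp only <;> infer_instance
  · rcases x with a | ⟨i, j⟩ <;> rcases y with b | ⟨k, l⟩ <;> dsimp only <;> infer_instance

theorem nonempty_iso_treeH11 : Nonempty (bipartiteGraph treeH11Nbhd ≃g treeH11) := by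
  have hinj : Function.Injective treeH11Vertex := by unfold Function.Injective; decide
  have hbij : Function.Bijective treeH11Vertex :=
    (Fintype.bijective_iff_injective_and_card _).mpr ⟨hinj, by decide⟩
  refine ⟨⟨Equiv.ofBijective _ hbij, ?_⟩⟩
  intro x y
  revert x y
  simp only [Equiv.ofBijective_apply]
  decide +kernel

/-! ### Five subsets of a set with six elements -/

/-- The symmetric matrix of order five with diagonal `v, w, x, y, z` and upper triangle
`a, …, j`, read row by row. -/
def symMatrix (v w x y z a b c d e f g h i j : ℕ) : Matrix (Fin 5) (Fin 5) ℕ :=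
  !![v, a, b, c, d; a, w, e, f, g; b, e, x, h, i; c, f, h, y, j; d, g, i, j, z]

/-- The expansion of `(symMatrix v w … j ^ 3).trace`. -/
def symTraceCube (v w x y z a b c d e f g h i j : ℕ) : ℕ :=
  v * v * v + w * w * w + x * x * x + y * y * y + z * z * z
  + 3 * (a * a * (v + w) + b * b * (v + x) + c * c * (v + y) + d * d * (v + z)
    + e * e * (w + x) + f * f * (w + y) + g * g * (w + z)
    + h * h * (x + y) + i * i * (x + z) + j * j * (y + z))
  + 6 * (a * b * e + a * c * f + a * d * g + b * c * h + b * d * i + c * d * j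
    + e * f * h + e * g * i + f * g * j + h * i * j)

/-- The expansion of `(symMatrix v w … j ^ 4).trace` as the sum of the squares of the entries of
the square of the matrix. -/
def symTraceFourth (v w x y z a b c d e f g h i j : ℕ) : ℕ :=
  let q (r₀ r₁ r₂ r₃ r₄ s₀ s₁ s₂ s₃ s₄ : ℕ) :=
    (r₀ * s₀ + r₁ * s₁ + r₂ * s₂ + r₃ * s₃ + r₄ * s₄)
      * (r₀ * s₀ + r₁ * s₁ + r₂ * s₂ + r₃ * s₃ + r₄ * s₄)
  q v a b c d v a b c d + q a w e f g a w e f g + q b e x h i b e x h i + q c f h y j c f h y j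
    + q d g i j z d g i j z
  + 2 * (q v a b c d a w e f g + q v a b c d b e x h i + q v a b c d c f h y j
    + q v a b c d d g i j z + q a w e f g b e x h i + q a w e f g c f h y j
    + q a w e f g d g i j z + q b e x h i c f h y j + q b e x h i d g i j z
    + q c f h y j d g i j z)

theorem trace_symMatrix_sq (v w x y z a b c d e f g h i j : ℕ) :
    (symMatrix v w x y z a b c d e f g h i j ^ 2).trace =
      v ^ 2 + w ^ 2 + x ^ 2 + y ^ 2 + z ^ 2
      + 2 * (a ^ 2 + b ^ 2 + c ^ 2 + d ^ 2 + e ^ 2 + f ^ 2 + g ^ 2 + h ^ 2 + i ^ 2 + j ^ 2) := by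
  simp [symMatrix, pow_succ, trace, Fin.sum_univ_succ]
  ring

theorem trace_symMatrix_cube (v w x y z a b c d e f g h i j : ℕ) :
    (symMatrix v w x y z a b c d e f g h i j ^ 3).trace =
      symTraceCube v w x y z a b c d e f g h i j := by
  simp [symTraceCube, symMatrix, pow_succ, trace, Fin.sum_univ_succ]
  ring

theorem trace_symMatrix_fourth (v w x y z a b c d e f g h i j : ℕ) :
    (symMatrix v w x y z a b c d e f g h i j ^ 4).trace =
      symTraceFourth v w x y z a b c d e f g h i j := by
  simp [symTraceFourth, symMatrix, pow_succ, trace, Fin.sum_univ_succ]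
  ring

/-- `2 + A`, where `A` is the adjacency matrix of the bowtie (two triangles sharing the
vertex `0`). -/
def bowtieGram : Matrix (Fin 5) (Fin 5) ℕ := symMatrix 2 2 2 2 2 1 1 1 1 1 0 0 0 0 1

/-- The possible sizes of the five sets, in increasing order. -/
theorem mem_of_sum_sq_le : ∀ v w x y z : Fin 5, v ≤ w → w ≤ x → x ≤ y → y ≤ z →
    (v : ℕ) + w + x + y + z = 10 →
    (v : ℕ) ^ 2 + (w : ℕ) ^ 2 + (x : ℕ) ^ 2 + (y : ℕ) ^ 2 + (z : ℕ) ^ 2 ≤ 24 →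
    ((v : ℕ), (w : ℕ), (x : ℕ), (y : ℕ), (z : ℕ)) ∈
      [(2, 2, 2, 2, 2), (1, 2, 2, 2, 3), (1, 1, 2, 3, 3)] := by
  decide +kernel

/-- No symmetric matrix with diagonal `1, 2, 2, 2, 3` and five off-diagonal pairs of ones has the
third and fourth power sums of the tree; checked on all `0`-`1` choices. -/
theorem symTraceFourth_ne_of_one_two_three : ∀ a b c d e f g h i j : Fin 2,
    (a : ℕ) + b + c + d + e + f + g + h + i + j = 5 →
    symTraceCube 1 2 2 2 3 a b c d e f g h i j = 124 →
    symTraceFourth 1 2 2 2 3 a b c d e f g h i j ≠ 516 := by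
  decide +kernel

theorem symTraceFourth_ne_of_one_three : ∀ a b c d e f g h i j : Fin 2,
    (a : ℕ) + b + c + d + e + f + g + h + i + j = 4 →
    symTraceCube 1 1 2 3 3 a b c d e f g h i j = 124 →
    symTraceFourth 1 1 2 3 3 a b c d e f g h i j ≠ 516 := by
  decide +kernel

/-- A graph with five vertices and six edges whose matrix `2 + A` has third and fourth power sums
`124` and `516` is the bowtie; checked on all graphs with vertex set `Fin 5`. -/
theorem exists_perm_eq_bowtieGram : ∀ a b c d e f g h i j : Fin 2,
    (a : ℕ) + b + c + d + e + f + g + h + i + j = 6 →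
    symTraceCube 2 2 2 2 2 a b c d e f g h i j = 124 →
    symTraceFourth 2 2 2 2 2 a b c d e f g h i j = 516 →
    ∃ σ : Equiv.Perm (Fin 5),
      (symMatrix 2 2 2 2 2 a b c d e f g h i j).submatrix σ σ = bowtieGram := by
  decide +kernel

/-- The matrix of the cardinalities `#(S i ∩ S j)`, that is, `B * Bᵀ` for the biadjacency
matrix `B` of `bipartiteGraph S`. -/
def interCardMatrix (S : Fin 5 → Finset (Fin 6)) : Matrix (Fin 5) (Fin 5) ℕ :=
  of fun i j => (S i ∩ S j).card

/-- The first two terms of Bonferroni's inequality for the union of five sets. -/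
theorem sum_card_le_card_add {α : Type*} [Fintype α] [DecidableEq α] (S : Fin 5 → Finset α) :
    (S 0).card + (S 1).card + (S 2).card + (S 3).card + (S 4).card ≤
      Fintype.card α
        + ((S 0 ∩ S 1).card + (S 0 ∩ S 2).card + (S 0 ∩ S 3).card + (S 0 ∩ S 4).card
        + (S 1 ∩ S 2).card + (S 1 ∩ S 3).card + (S 1 ∩ S 4).card
        + (S 2 ∩ S 3).card + (S 2 ∩ S 4).card + (S 3 ∩ S 4).card) := by
  have hc : ∀ T : Finset α, T.card = ∑ k, if k ∈ T then 1 else 0 := by simp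
  have hα : Fintype.card α = ∑ _k : α, 1 := by simp
  simp only [hc, hα, ← Finset.sum_add_distrib, Finset.mem_inter]
  refine Finset.sum_le_sum fun k _ => ?_
  by_cases h0 : k ∈ S 0 <;> by_cases h1 : k ∈ S 1 <;> by_cases h2 : k ∈ S 2 <;>
    by_cases h3 : k ∈ S 3 <;> by_cases h4 : k ∈ S 4 <;> simp [h0, h1, h2, h3, h4]

theorem lt_two_of_sq_lt {k : ℕ} (h : k ^ 2 < k + 2) : k < 2 := by
  nlinarith

theorem card_inter_le_one_of_card_eq_two {α : Type*} [DecidableEq α] {s t : Finset α}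
    (hs : s.card = 2) (ht : t.card = 2) (hst : s ≠ t) : (s ∩ t).card ≤ 1 := by
  by_contra! h
  have h1 : s ∩ t = s := Finset.eq_of_subset_of_card_le Finset.inter_subset_left (by omega)
  have h2 : s ∩ t = t := Finset.eq_of_subset_of_card_le Finset.inter_subset_right (by omega)
  exact hst (h1.symm.trans h2)

/-- Five distinct subsets of `Fin 6`, sorted by size, whose intersection matrix has the first four
power sums of the tree, are pairs forming a bowtie. -/
theorem exists_perm_interCardMatrix_eq (S : Fin 5 → Finset (Fin 6)) (hS : Function.Injective S)
    (hmono : Monotone fun i => (S i).card) (h1 : (interCardMatrix S).trace = 10)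
    (h2 : (interCardMatrix S ^ 2).trace = 32) (h3 : (interCardMatrix S ^ 3).trace = 124)
    (h4 : (interCardMatrix S ^ 4).trace = 516) :
    ∃ σ : Equiv.Perm (Fin 5), interCardMatrix (S ∘ σ) = bowtieGram := by
  have hsub : ∀ σ : Equiv.Perm (Fin 5),
      interCardMatrix (S ∘ σ) = (interCardMatrix S).submatrix σ σ := fun _ => rfl
  simp only [hsub]
  have hB := sum_card_le_card_add S
  rw [Fintype.card_fin] at hB
  have hN : interCardMatrix S = symMatrix (S 0).card (S 1).card (S 2).card (S 3).card (S 4).card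
      (S 0 ∩ S 1).card (S 0 ∩ S 2).card (S 0 ∩ S 3).card (S 0 ∩ S 4).card
      (S 1 ∩ S 2).card (S 1 ∩ S 3).card (S 1 ∩ S 4).card
      (S 2 ∩ S 3).card (S 2 ∩ S 4).card (S 3 ∩ S 4).card := by
    ext i j
    fin_cases i <;> fin_cases j <;> simp [interCardMatrix, symMatrix] <;>
      rw [Finset.inter_comm]
  have htwins : ∀ i j, i ≠ j → (S i).card = 2 → (S j).card = 2 → (S i ∩ S j).card ≤ 1 :=
    fun i j hij hi hj => card_inter_le_one_of_card_eq_two hi hj (hS.ne hij)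
  have t01 := htwins 0 1 (by decide)
  have t02 := htwins 0 2 (by decide)
  have t03 := htwins 0 3 (by decide)
  have t04 := htwins 0 4 (by decide)
  have t12 := htwins 1 2 (by decide)
  have t13 := htwins 1 3 (by decide)
  have t14 := htwins 1 4 (by decide)
  have t23 := htwins 2 3 (by decide)
  have t24 := htwins 2 4 (by decide)
  have t34 := htwins 3 4 (by decide)
  have m01 : (S 0).card ≤ (S 1).card := hmono (by decide)
  have m12 : (S 1).card ≤ (S 2).card := hmono (by decide)
  have m23 : (S 2).card ≤ (S 3).card := hmono (by decide)
  have m34 : (S 3).card ≤ (S 4).card := hmono (by decide)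
  rw [hN] at h1 h2 h3 h4 ⊢
  rw [trace_symMatrix_sq] at h2
  rw [trace_symMatrix_cube] at h3
  rw [trace_symMatrix_fourth] at h4
  replace h1 : (S 0).card + (S 1).card + (S 2).card + (S 3).card + (S 4).card = 10 := by
    rw [← h1]; simp [symMatrix, trace, Fin.sum_univ_succ]; ring
  clear hN htwins hmono hS hsub
  generalize (S 0).card = v at *
  generalize (S 1).card = w at *
  generalize (S 2).card = x at *
  generalize (S 3).card = y at *
  generalize (S 4).card = z at *
  generalize (S 0 ∩ S 1).card = a at *
  generalize (S 0 ∩ S 2).card = b at *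
  generalize (S 0 ∩ S 3).card = c at *
  generalize (S 0 ∩ S 4).card = d at *
  generalize (S 1 ∩ S 2).card = e at *
  generalize (S 1 ∩ S 3).card = f at *
  generalize (S 1 ∩ S 4).card = g at *
  generalize (S 2 ∩ S 3).card = h at *
  generalize (S 2 ∩ S 4).card = i at *
  generalize (S 3 ∩ S 4).card = j at *
  have hle : ∀ k : ℕ, k ≤ k ^ 2 := fun k => Nat.le_self_pow two_ne_zero k
  -- The intersection sizes add up to at least `4` by Bonferroni's inequality, hence so do their
  -- squares, and the second trace leaves at most `24` for the squares of the diagonal.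
  have hsq : v ^ 2 + w ^ 2 + x ^ 2 + y ^ 2 + z ^ 2 ≤ 24 := by
    linarith [hle a, hle b, hle c, hle d, hle e, hle f, hle g, hle h, hle i, hle j]
  have hz : z < 5 := lt_of_pow_lt_pow_left₀ 2 (by norm_num)
    (((Nat.le_add_left _ _).trans hsq).trans_lt (by norm_num))
  have hcases := mem_of_sum_sq_le ⟨v, by omega⟩ ⟨w, by omega⟩ ⟨x, by omega⟩ ⟨y, by omega⟩ ⟨z, hz⟩
    m01 m12 m23 m34 h1 hsq
  simp only [List.mem_cons, List.not_mem_nil, or_false, Prod.mk.injEq] at hcases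
  have sq_of_lt : ∀ k : ℕ, k < 2 → k ^ 2 = k := by decide
  -- An intersection of size at least `2` is impossible: among sets of size two it makes two of
  -- them equal, and otherwise the squares exceed the sizes by too much for the second trace.
  have hsmall : a < 2 ∧ b < 2 ∧ c < 2 ∧ d < 2 ∧ e < 2 ∧ f < 2 ∧ g < 2 ∧ h < 2 ∧ i < 2 ∧ j < 2 := by
    rcases hcases with ⟨rfl, rfl, rfl, rfl, rfl⟩ | ⟨rfl, rfl, rfl, rfl, rfl⟩ |
      ⟨rfl, rfl, rfl, rfl, rfl⟩
    · simp at t01 t02 t03 t04 t12 t13 t14 t23 t24 t34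
      omega
    all_goals
      refine ⟨?_, ?_, ?_, ?_, ?_, ?_, ?_, ?_, ?_, ?_⟩ <;> apply lt_two_of_sq_lt <;>
        linarith [hle a, hle b, hle c, hle d, hle e, hle f, hle g, hle h, hle i, hle j]
  obtain ⟨ha, hb, hc, hd, he, hf, hg, hh, hi, hj⟩ := hsmall
  rw [sq_of_lt a ha, sq_of_lt b hb, sq_of_lt c hc, sq_of_lt d hd, sq_of_lt e he, sq_of_lt f hf,
    sq_of_lt g hg, sq_of_lt h hh, sq_of_lt i hi, sq_of_lt j hj] at h2
  rcases hcases with ⟨rfl, rfl, rfl, rfl, rfl⟩ | ⟨rfl, rfl, rfl, rfl, rfl⟩ |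
    ⟨rfl, rfl, rfl, rfl, rfl⟩
  · exact exists_perm_eq_bowtieGram ⟨a, ha⟩ ⟨b, hb⟩ ⟨c, hc⟩ ⟨d, hd⟩ ⟨e, he⟩ ⟨f, hf⟩ ⟨g, hg⟩
      ⟨h, hh⟩ ⟨i, hi⟩ ⟨j, hj⟩ (by simp; omega) h3 h4
  · exact absurd h4 (symTraceFourth_ne_of_one_two_three ⟨a, ha⟩ ⟨b, hb⟩ ⟨c, hc⟩ ⟨d, hd⟩ ⟨e, he⟩
      ⟨f, hf⟩ ⟨g, hg⟩ ⟨h, hh⟩ ⟨i, hi⟩ ⟨j, hj⟩ (by simp; omega) h3)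
  · exact absurd h4 (symTraceFourth_ne_of_one_three ⟨a, ha⟩ ⟨b, hb⟩ ⟨c, hc⟩ ⟨d, hd⟩ ⟨e, he⟩
      ⟨f, hf⟩ ⟨g, hg⟩ ⟨h, hh⟩ ⟨i, hi⟩ ⟨j, hj⟩ (by simp; omega) h3)

/-! ### Reconstruction of the tree -/

/-- The bowtie determines the five pairs: a triangle of three pairs `{a, b}, {a, c}, {b, c}` cannot
occur, because every further pair meeting `{a, b}` would meet one of the other two. -/
theorem exists_perm_mem_iff_of_interCardMatrix_eq {S : Fin 5 → Finset (Fin 6)}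
    (hS : interCardMatrix S = bowtieGram) :
    ∃ τ : Equiv.Perm (Fin 6), ∀ i j, τ j ∈ S i ↔ j ∈ treeH11Nbhd i := by
  have hc : ∀ i j, (S i ∩ S j).card = bowtieGram i j := fun i j => congrFun (congrFun hS i) j
  have hcard : ∀ i, (S i).card = 2 := by
    intro i
    rw [← Finset.inter_self (S i), hc]
    fin_cases i <;> rfl
  have hmeet : ∀ i j, bowtieGram i j = 1 → ∃ k, k ∈ S i ∧ k ∈ S j := by
    intro i j hij
    obtain ⟨k, hk⟩ := Finset.card_eq_one.mp ((hc i j).trans hij)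
    exact ⟨k, Finset.mem_inter.mp (hk ▸ Finset.mem_singleton_self k)⟩
  have hdisj : ∀ i j, bowtieGram i j = 0 → ∀ k, k ∈ S i → k ∉ S j := by
    intro i j hij k hi hj
    have := Finset.card_eq_zero.mp ((hc i j).trans hij)
    exact Finset.notMem_empty k (this ▸ Finset.mem_inter.mpr ⟨hi, hj⟩)
  have hpair : ∀ i k, k ∈ S i → ∃ l, k ≠ l ∧ S i = {k, l} := by
    intro i k hk
    obtain ⟨x, y, hxy, h⟩ := Finset.card_eq_two.mp (hcard i)
    rw [h, Finset.mem_insert, Finset.mem_singleton] at hk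
    rcases hk with rfl | rfl
    · exact ⟨y, hxy, h⟩
    · exact ⟨x, hxy.symm, h.trans (Finset.pair_comm _ _)⟩
  have h13 := hdisj 1 3 rfl
  have h14 := hdisj 1 4 rfl
  have h23 := hdisj 2 3 rfl
  have h24 := hdisj 2 4 rfl
  obtain ⟨a, ha0, ha1⟩ := hmeet 0 1 rfl
  obtain ⟨a', ha'0, ha'2⟩ := hmeet 0 2 rfl
  obtain ⟨b, hb0, hb3⟩ := hmeet 0 3 rfl
  obtain ⟨b', hb'0, hb'4⟩ := hmeet 0 4 rfl
  have hab : a ≠ b := by rintro rfl; exact h13 _ ha1 hb3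
  obtain ⟨l, -, h0⟩ := hpair 0 a ha0
  obtain rfl : b = l := by
    rw [h0, Finset.mem_insert, Finset.mem_singleton] at hb0
    exact hb0.resolve_left hab.symm
  rw [h0, Finset.mem_insert, Finset.mem_singleton] at ha'0 hb'0
  -- `S 1` and `S 2` meet `S 0` in the same point, for otherwise `S 2` would meet `S 3`.
  obtain rfl : a' = a := ha'0.resolve_right (by rintro rfl; exact h23 _ ha'2 hb3)
  obtain rfl : b' = b := hb'0.resolve_left (by rintro rfl; exact h14 _ ha1 hb'4)
  obtain ⟨c, hac, h1⟩ := hpair 1 a' ha1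
  obtain ⟨d, had, h2⟩ := hpair 2 a' ha'2
  obtain ⟨e, hbe, h3⟩ := hpair 3 b' hb3
  obtain ⟨f, hbf, h4⟩ := hpair 4 b' hb'4
  have hcd : c ≠ d := by
    rintro rfl
    have := hc 1 2
    rw [h1, h2, Finset.inter_self, Finset.card_pair hac] at this
    simp [bowtieGram, symMatrix] at this
  have hef : e ≠ f := by
    rintro rfl
    have := hc 3 4
    rw [h3, h4, Finset.inter_self, Finset.card_pair hbe] at this
    simp [bowtieGram, symMatrix] at this
  simp only [h1, h2, h3, h4, Finset.mem_insert, Finset.mem_singleton] at h13 h14 h23 h24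
  have hinj : Function.Injective ![a', b', c, d, e, f] := by
    rw [← List.nodup_ofFn]
    simp
    grind
  refine ⟨Equiv.ofBijective _ (Finite.injective_iff_bijective.mp hinj), ?_⟩
  have hrow : ∀ i, S i = (treeH11Nbhd i).map ⟨_, hinj⟩ := by
    intro i
    fin_cases i <;> simp [treeH11Nbhd, h0, h1, h2, h3, h4]
  intro i j
  rw [hrow, Equiv.ofBijective_apply]
  exact Finset.mem_map' ⟨_, hinj⟩

theorem interCardMatrix_treeH11Nbhd : interCardMatrix treeH11Nbhd = bowtieGram := by
  decide

theorem ten_le_rank_treeH11Nbhd : 10 ≤ ((bipartiteGraph treeH11Nbhd).adjMatrix ℝ).rank := by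
  -- The right factor is a right inverse: it expresses each pair through the elements `1, …, 5`,
  -- the element `0` being left out.
  have h : biadjMatrix ℝ treeH11Nbhd *
      !![0, 0, 0, 0, 0; 1, 0, 0, 0, 0; 0, 1, 0, 0, 0; 0, 0, 1, 0, 0; -1, 0, 0, 1, 0;
        -1, 0, 0, 0, (1 : ℝ)] = 1 := by
    ext i j
    fin_cases i <;> fin_cases j <;>
      simp [biadjMatrix, treeH11Nbhd, mul_apply, Fin.sum_univ_succ, Finset.filter_singleton]
  rw [adjMatrix_bipartiteGraph]
  exact le_rank_fromBlocks _ h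

theorem nonempty_iso_of_adjSpectrum_eq {S : Fin 5 → Finset (Fin 6)}
    (hmono : Monotone fun i => (S i).card)
    (h : (bipartiteGraph S).adjSpectrum = (bipartiteGraph treeH11Nbhd).adjSpectrum) :
    Nonempty (bipartiteGraph S ≃g bipartiteGraph treeH11Nbhd) := by
  -- Two equal neighbourhoods would bring the rank of the adjacency matrix below `10`.
  have hinj : Function.Injective S := by
    have hle := ten_le_rank_treeH11Nbhd
    have hsub : biadjMatrix ℝ S =
        (biadjMatrix ℝ (fun T : Set.range S => T.1)).submatrix (Set.rangeFactorization S) id := rfl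
    rw [← SimpleGraph.rank_adjMatrix_eq_of_adjSpectrum_eq h, adjMatrix_bipartiteGraph,
      hsub] at hle
    have hrank := hle.trans (rank_fromBlocks_submatrix_le _ _ _)
    rw [Fintype.card_fin] at hrank
    have hle' : Fintype.card (Set.range S) ≤ Fintype.card (Fin 5) :=
      Fintype.card_le_of_surjective _ (Set.rangeFactorization_surjective (f := S))
    rw [Fintype.card_fin] at hle'
    exact Set.rangeFactorization_injective.mp ((Fintype.bijective_iff_surjective_and_card _).mpr
      ⟨Set.rangeFactorization_surjective, by rw [Fintype.card_fin]; omega⟩).injective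
  have htrace : ∀ k, k ≠ 0 →
      (interCardMatrix S ^ k).trace = (bowtieGram ^ k).trace := by
    intro k hk
    have := SimpleGraph.trace_adjMatrix_pow_eq_of_adjSpectrum_eq h (2 * k)
    rw [adjMatrix_bipartiteGraph, adjMatrix_bipartiteGraph, trace_fromBlocks_pow_two_mul _ hk,
      trace_fromBlocks_pow_two_mul _ hk, biadjMatrix_mul_transpose,
      biadjMatrix_mul_transpose] at this
    rw [← interCardMatrix_treeH11Nbhd]
    exact Nat.eq_of_mul_eq_mul_left two_pos this
  obtain ⟨σ, hσ⟩ := exists_perm_interCardMatrix_eq S hinj hmono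
    (by rw [← pow_one (interCardMatrix S), htrace 1 one_ne_zero, pow_one]; decide)
    (by rw [htrace 2 two_ne_zero, bowtieGram, trace_symMatrix_sq]; norm_num)
    (by rw [htrace 3 three_ne_zero, bowtieGram, trace_symMatrix_cube]; rfl)
    (by rw [htrace 4 four_ne_zero, bowtieGram, trace_symMatrix_fourth]; rfl)
  obtain ⟨τ, hτ⟩ := exists_perm_mem_iff_of_interCardMatrix_eq hσ
  exact ⟨(bipartiteGraphIso σ τ hτ).symm⟩

theorem mainTheorem7 : SimpleGraph.IsDS.{0, u} treeH11 := by
  classical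
  intro W _ G hG
  obtain ⟨e₀⟩ := nonempty_iso_treeH11
  rw [← SimpleGraph.adjSpectrum_eq_of_iso e₀] at hG
  have hcol : G.Colorable 2 := by
    refine G.colorable_two_of_trace_odd_pow fun k hk => ?_
    rw [SimpleGraph.trace_adjMatrix_pow_eq_of_adjSpectrum_eq hG, adjMatrix_bipartiteGraph,
      trace_fromBlocks_pow_odd _ hk]
  have hcard : Fintype.card W = 11 := by
    rw [← G.card_adjSpectrum, hG, SimpleGraph.card_adjSpectrum]
    rfl
  obtain ⟨a, b, hab, hsum, S, ⟨e⟩⟩ := hcol.exists_iso_bipartiteGraph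
  rw [SimpleGraph.adjSpectrum_eq_of_iso e] at hG
  -- The nullity is one, which leaves only sides of sizes `5` and `6`.
  have hrank : 10 ≤ a + a := by
    have hle := ten_le_rank_treeH11Nbhd
    rw [← SimpleGraph.rank_adjMatrix_eq_of_adjSpectrum_eq hG, adjMatrix_bipartiteGraph] at hle
    simpa using hle.trans (rank_fromBlocks_submatrix_le (biadjMatrix ℝ S) id _)
  obtain rfl : a = 5 := by omega
  obtain rfl : b = 6 := by omega
  -- The smaller side is numbered so that the degrees increase.
  let e' : bipartiteGraph (S ∘ Tuple.sort fun i => (S i).card) ≃g bipartiteGraph S :=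
    bipartiteGraphIso (Tuple.sort fun i => (S i).card) (Equiv.refl _) fun _ _ => Iff.rfl
  obtain ⟨e''⟩ := nonempty_iso_of_adjSpectrum_eq (Tuple.monotone_sort fun i => (S i).card)
    ((SimpleGraph.adjSpectrum_eq_of_iso e').trans hG)
  exact ⟨((e.trans e'.symm).trans e'').trans e₀⟩
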